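/- Let $a>0$, $b\in\mathbb R$ and $c\in\mathbb R$ satisfy $c^2\in(0,2)$ and $b/a\in(0,c^4/4)$. Consider the problem $$u_{\tau\tau}+u_{xxxx}+a u^+-b u^-=1,\quad x\in\mathbb R,\ \tau>0,\qquad u(x,\tau)\to \tfrac1a,\quad u_x(x,\tau)\to 0\quad\text{as } |x|\to+\infty,\qquad (1)$$ where $u^{\pm}=\max\{\pm u,0\}$. A travelling wave solution of (1) (with speed $\sqrt[4]{a}\,c$) is a classical solution of the form $a\,u(x,\tau)=y(\sqrt[4]{a}\,x-c\sqrt a\,\tau)$; it is called even if the profile $y$ is an even function, and one-troughed if there are exactly two points $t\in\mathbb R$ with $z(t)=-1$, where $z=y-1$ (that is, with $y(t)=0$). Then, for the given $a,b,c$, problem (1) has at most $6$ even one-troughed travelling wave solutions. -/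

import Mathlib

open Set Filter Topology

/-- `u = u(x, τ)` is a classical solution of the beam equation with jumping nonlinearity
`u_ττ + u_xxxx + a u⁺ - b u⁻ = 1` for `x ∈ ℝ`, `τ > 0`, with `u(x, τ) → 1/a` and
`u_x(x, τ) → 0` as `|x| → ∞`. Here `u⁺ = max u 0` and `u⁻ = max (-u) 0`. -/
structure IsBeamSolution (a b : ℝ) (u : ℝ → ℝ → ℝ) : Prop where
  contDiff_space : ∀ τ : ℝ, 0 < τ → ContDiff ℝ 4 (fun x => u x τ)
  contDiff_time : ∀ x : ℝ, ContDiffOn ℝ 2 (fun τ => u x τ) (Ioi 0)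
  equation : ∀ x τ : ℝ, 0 < τ →
    iteratedDeriv 2 (fun s => u x s) τ + iteratedDeriv 4 (fun r => u r τ) x
      + a * max (u x τ) 0 - b * max (-(u x τ)) 0 = 1
  tendsto_value : ∀ τ : ℝ, 0 < τ → Tendsto (fun x => u x τ) (cocompact ℝ) (𝓝 (1 / a))
  tendsto_slope : ∀ τ : ℝ, 0 < τ →
    Tendsto (fun x => deriv (fun r => u r τ) x) (cocompact ℝ) (𝓝 0)

/-- `u` is the travelling wave with profile `y` and (signed) speed `a^(1/4) c`:
`a u(x, τ) = y(a^(1/4) x - c √a τ)`. -/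
def IsTravellingWave (a c : ℝ) (u : ℝ → ℝ → ℝ) (y : ℝ → ℝ) : Prop :=
  ∀ x τ : ℝ, a * u x τ = y (a ^ (1 / 4 : ℝ) * x - c * √a * τ)

/-- A profile `y` is one-troughed if there are exactly two points `t` with `z t = -1`,
where `z = y - 1` is the deviation from the equilibrium `y ≡ 1`. -/
def IsOneTroughed (y : ℝ → ℝ) : Prop :=
  {t : ℝ | y t - 1 = -1}.encard = 2

/-- The set of even one-troughed travelling wave solutions of the beam problem, for fixed
parameters `a`, `b` and fixed wave speed `a^(1/4) c`. -/
def evenOneTroughedWaves (a b c : ℝ) : Set (ℝ → ℝ → ℝ) :=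
  {u | IsBeamSolution a b u ∧
    ∃ y : ℝ → ℝ, IsTravellingWave a c u y ∧ Function.Even y ∧ IsOneTroughed y}

/-!
The profile `y` of a wave solves `y⁗ + γ y″ + y⁺ - β y⁻ = 1` with `γ = c²`, `β = b / a`. If it is even
and has exactly two zeros `± T`, then `y < 0` between them and `y > 0` outside, so it is glued from
solutions of two linear equations.

Outside, `y - 1` decays, hence solves `z″ + 2 α z′ + z = 0` (`IsHomoclinicProfile.stable`). The slope
`s = y′(T)` therefore determines all derivatives of `y` at `T`, and with them the whole profile
(`IsHomoclinicProfile.eq_of_edge`). Inside, `y = 1/β + A cos (p t) + B cos (q t)`, where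
`p² + q² = γ`, `p² q² = β` and `p < q`. In polar form, matching at `T` says that, modulo `π`,
`k T = arctan (k s) - φ_k` for `k = p` and `k = q`, where `φ_k` is the argument of
`1 - k² + 2 α i k` (`exitPhase`). The low frequency has the larger amplitude, so the sign of `y` in
the trough leaves only `p T = arctan (p s) - φ_p`
(`IsHomoclinicProfile.exists_isTroughEdge`). For the high frequency an integer remains:
`q T = arctan (q s) - φ_q + n π`.

Since `arctan (p s) / p - arctan (q s) / q` is strictly increasing in `s > 0`, the integer `n`
determines `s` and `T` (`IsTroughEdge.unique`), and it suffices to show `0 ≤ n ≤ 5`. The lower bound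
is clear from `q T > 0`. For the upper bound, `y` must not return to `0` after `T`, which limits the
slope of the damped oscillator `y - 1` (`IsHomoclinicProfile.slope_lt`); together with `T ≤ s - 2 α`
(`IsTroughEdge.edge_le`) this makes `q T` a little less than `6 π` at most, uniformly in the
parameters (`slope_bound_of_le_one`, `slope_bound_of_one_lt`).
-/

/-! ### Linear oscillators -/

theorem exists_eq_cos_add_sin {k : ℝ} (hk : k ≠ 0) {I : Set ℝ} (hI : Convex ℝ I) {x x₁ : ℝ → ℝ}
    (hx : ∀ t ∈ I, HasDerivAt x (x₁ t) t) (hx₁ : ∀ t ∈ I, HasDerivAt x₁ (-(k ^ 2 * x t)) t) :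
    ∃ C S : ℝ, ∀ t ∈ I, x t = C * Real.cos (k * t) + S * Real.sin (k * t) ∧
      x₁ t = k * (S * Real.cos (k * t) - C * Real.sin (k * t)) := by
  have hcos : ∀ t, HasDerivAt (fun t => Real.cos (k * t)) (-(k * Real.sin (k * t))) t := by
    intro t
    exact ((hasDerivAt_id' t).const_mul k).cos.congr_deriv (by ring)
  have hsin : ∀ t, HasDerivAt (fun t => Real.sin (k * t)) (k * Real.cos (k * t)) t := by
    intro t
    exact ((hasDerivAt_id' t).const_mul k).sin.congr_deriv (by ring)
  have key : ∀ F : ℝ → ℝ, (∀ t ∈ I, HasDerivAt F 0 t) → ∃ C, ∀ t ∈ I, F t = C := by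
    intro F hF
    rcases I.eq_empty_or_nonempty with rfl | ⟨a, ha⟩
    · exact ⟨0, by simp⟩
    · refine ⟨F a, fun t ht => ?_⟩
      have := hI.norm_image_sub_le_of_norm_hasDerivWithin_le (C := 0)
        (fun u hu => (hF u hu).hasDerivWithinAt) (by simp) ha ht
      simpa [sub_eq_zero] using this
  obtain ⟨C, hC⟩ := key (fun t => x t * Real.cos (k * t) - x₁ t / k * Real.sin (k * t)) (by
    intro t ht
    have := ((hx t ht).mul (hcos t)).sub (((hx₁ t ht).div_const k).mul (hsin t))
    refine this.congr_deriv ?_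
    field_simp
    ring)
  obtain ⟨S, hS⟩ := key (fun t => x t * Real.sin (k * t) + x₁ t / k * Real.cos (k * t)) (by
    intro t ht
    have := ((hx t ht).mul (hsin t)).add (((hx₁ t ht).div_const k).mul (hcos t))
    refine this.congr_deriv ?_
    field_simp
    ring)
  refine ⟨C, S, fun t ht => ?_⟩
  rw [← hC t ht, ← hS t ht]
  have h1 := Real.sin_sq_add_cos_sq (k * t)
  constructor
  · linear_combination (-x t) * h1
  · field_simp
    linear_combination (-x₁ t) * h1

/-- Solutions of `x'' + 2 μ x' + x = 0` with `μ² + k² = 1`; `μ` may have either sign. -/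
theorem exists_exp_mul_eq_cos_add_sin {k μ : ℝ} (hk : k ≠ 0) (hμ : μ ^ 2 + k ^ 2 = 1) {I : Set ℝ}
    (hI : Convex ℝ I) {x x₁ : ℝ → ℝ} (hx : ∀ t ∈ I, HasDerivAt x (x₁ t) t)
    (hx₁ : ∀ t ∈ I, HasDerivAt x₁ (-(2 * μ * x₁ t) - x t) t) :
    ∃ C S : ℝ, ∀ t ∈ I, Real.exp (μ * t) * x t = C * Real.cos (k * t) + S * Real.sin (k * t) ∧
      Real.exp (μ * t) * (x₁ t + μ * x t) =
        k * (S * Real.cos (k * t) - C * Real.sin (k * t)) := by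
  have hexp : ∀ t, HasDerivAt (fun t => Real.exp (μ * t)) (Real.exp (μ * t) * μ) t := by
    intro t
    have := ((hasDerivAt_id t).const_mul μ).exp
    simpa using this
  refine exists_eq_cos_add_sin hk hI (fun t ht => ?_) (fun t ht => ?_)
  · refine ((hexp t).mul (hx t ht)).congr_deriv ?_
    ring
  · refine ((hexp t).mul ((hx₁ t ht).add ((hx t ht).const_mul μ))).congr_deriv ?_
    simp only [Pi.add_apply]
    linear_combination (Real.exp (μ * t) * x t) * hμ

/-- A sinusoid that decays at infinity vanishes. -/
theorem eq_zero_of_tendsto_cos_add_sin {k C S : ℝ} (hk : 0 < k)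
    (h : Tendsto (fun t => C * Real.cos (k * t) + S * Real.sin (k * t)) atTop (𝓝 0)) :
    C = 0 ∧ S = 0 := by
  have hseq : ∀ d : ℝ, Tendsto (fun n : ℕ => (d + n * (2 * Real.pi)) / k) atTop atTop := by
    intro d
    refine Tendsto.atTop_div_const hk (tendsto_atTop_add_const_left _ _ ?_)
    exact tendsto_natCast_atTop_atTop.atTop_mul_const (by positivity)
  have h1 := h.comp (hseq 0)
  have h2 := h.comp (hseq (Real.pi / 2))
  have e : ∀ d (n : ℕ), k * ((d + n * (2 * Real.pi)) / k) = d + n * (2 * Real.pi) := by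
    intro d n; field_simp
  simp only [Function.comp_def, e, Real.cos_add_nat_mul_two_pi, Real.sin_add_nat_mul_two_pi] at h1 h2
  simp only [Real.cos_zero, Real.sin_zero, Real.cos_pi_div_two, Real.sin_pi_div_two, mul_one,
    mul_zero, add_zero, zero_add, tendsto_const_nhds_iff] at h1 h2
  exact ⟨h1, h2⟩

/-! ### Homoclinic profiles and their stable tail -/

theorem Function.Even.odd_of_hasDerivAt {f f' : ℝ → ℝ} (he : Function.Even f)
    (hf : ∀ t, HasDerivAt f (f' t) t) : Function.Odd f' := by
  intro t
  have h1 := (hf (-t)).scomp t (hasDerivAt_neg t)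
  have h2 : f ∘ (fun t => -t) = f := funext he
  have h3 := (show HasDerivAt f _ t from h2 ▸ h1).unique (hf t)
  simp at h3
  linarith

theorem Function.Odd.even_of_hasDerivAt {f f' : ℝ → ℝ} (ho : Function.Odd f)
    (hf : ∀ t, HasDerivAt f (f' t) t) : Function.Even f' := by
  intro t
  have h1 := (hf (-t)).scomp t (hasDerivAt_neg t)
  have h2 : f ∘ (fun t => -t) = -f := funext ho
  have h3 := (show HasDerivAt (-f) _ t from h2 ▸ h1).unique (hf t).neg
  simp at h3
  linarith

/-- `y` is an even profile, with `y₁, y₂, y₃` its first three derivatives, of the travelling wave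
equation `y⁗ + γ y″ + y⁺ - β y⁻ = 1`, homoclinic to the equilibrium `1`. -/
structure IsHomoclinicProfile (γ β : ℝ) (y y₁ y₂ y₃ : ℝ → ℝ) : Prop where
  even : Function.Even y
  deriv_zero : ∀ t, HasDerivAt y (y₁ t) t
  deriv_one : ∀ t, HasDerivAt y₁ (y₂ t) t
  deriv_two : ∀ t, HasDerivAt y₂ (y₃ t) t
  deriv_three : ∀ t, HasDerivAt y₃ (1 - γ * y₂ t - max (y t) 0 + β * max (-(y t)) 0) t
  tendsto_value : Tendsto y atTop (𝓝 1)
  tendsto_slope : Tendsto y₁ atTop (𝓝 0)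

/-- Where `y ≤ 0` the characteristic roots are `± i p`, `± i q`; where `y ≥ 0` they are
`± α ± i ω`. -/
structure IsSpectralData (γ β p q α ω : ℝ) : Prop where
  p_pos : 0 < p
  p_lt_q : p < q
  add_sq : p ^ 2 + q ^ 2 = γ
  mul_sq : p ^ 2 * q ^ 2 = β
  α_pos : 0 < α
  ω_pos : 0 < ω
  α_sq : 4 * α ^ 2 = 2 - γ
  ω_sq : 4 * ω ^ 2 = 2 + γ

variable {γ β p q α ω : ℝ} {y y₁ y₂ y₃ : ℝ → ℝ}

theorem exists_isSpectralData {γ β : ℝ} (hγ : γ ∈ Ioo 0 2) (hβ : β ∈ Ioo 0 (γ ^ 2 / 4)) :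
    ∃ p q α ω, IsSpectralData γ β p q α ω := by
  obtain ⟨h0, h2⟩ := hγ
  obtain ⟨hb0, hb⟩ := hβ
  have hD : 0 < γ ^ 2 - 4 * β := by linarith
  have hs := Real.sq_sqrt hD.le
  have hs0 := Real.sqrt_pos.2 hD
  set D := √(γ ^ 2 - 4 * β)
  have hDγ : D < γ := by nlinarith
  have hp := Real.sq_sqrt (show 0 ≤ (γ - D) / 2 by linarith)
  have hq := Real.sq_sqrt (show 0 ≤ (γ + D) / 2 by linarith)
  have ha := Real.sq_sqrt (show 0 ≤ (2 - γ) / 4 by linarith)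
  have ho := Real.sq_sqrt (show 0 ≤ (2 + γ) / 4 by linarith)
  refine ⟨√((γ - D) / 2), √((γ + D) / 2), √((2 - γ) / 4), √((2 + γ) / 4),
    Real.sqrt_pos.2 (by linarith), Real.sqrt_lt_sqrt (by linarith) (by linarith), by linarith, ?_,
    Real.sqrt_pos.2 (by linarith), Real.sqrt_pos.2 (by linarith), by linarith, by linarith⟩
  rw [hp, hq]
  linear_combination (-1 / 4) * hs

namespace IsSpectralData

variable (h : IsSpectralData γ β p q α ω)
include h

theorem q_pos : 0 < q := h.p_pos.trans h.p_lt_q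

theorem sq_lt_sq : p ^ 2 < q ^ 2 := by
  have := h.p_pos; have := h.p_lt_q; nlinarith

theorem α_sq_add_ω_sq : α ^ 2 + ω ^ 2 = 1 := by
  linarith [h.α_sq, h.ω_sq]

theorem γ_lt_two : γ < 2 := by nlinarith [h.α_sq, h.α_pos]

theorem β_lt_one : β < 1 := by
  have h1 := h.sq_lt_sq; have h2 := h.γ_lt_two
  have h3 := h.add_sq; have h4 := h.mul_sq
  nlinarith [sq_nonneg (p ^ 2 - q ^ 2), sq_nonneg p, sq_nonneg q]

theorem p_lt_one : p < 1 := by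
  have h1 := h.sq_lt_sq; have h2 := h.γ_lt_two
  have h3 := h.add_sq; have := h.p_pos
  nlinarith

end IsSpectralData

namespace IsHomoclinicProfile

theorem odd_deriv (hy : IsHomoclinicProfile γ β y y₁ y₂ y₃) : Function.Odd y₁ :=
  hy.even.odd_of_hasDerivAt hy.deriv_zero

theorem even_deriv_two (hy : IsHomoclinicProfile γ β y y₁ y₂ y₃) : Function.Even y₂ :=
  hy.odd_deriv.even_of_hasDerivAt hy.deriv_one

theorem odd_deriv_three (hy : IsHomoclinicProfile γ β y y₁ y₂ y₃) : Function.Odd y₃ :=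
  hy.even_deriv_two.odd_of_hasDerivAt hy.deriv_two

/-- Beyond its last zero a profile lies on the stable manifold: it solves the decaying second order
equation `y″ + 2 α y′ + (y - 1) = 0`. The combinations `y″ ± 2 α y′ + (y - 1)` are oscillators, one
growing and one decaying, and their difference `4 α y′` tends to `0`. -/
theorem stable (hy : IsHomoclinicProfile γ β y y₁ y₂ y₃) (hp : IsSpectralData γ β p q α ω) {T : ℝ}
    (hT : ∀ t ∈ Ici T, 0 ≤ y t) :
    ∀ t ∈ Ici T, y₂ t + 2 * α * y₁ t + (y t - 1) = 0 ∧ y₃ t + 2 * α * y₂ t + y₁ t = 0 := by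
  have heq : ∀ t ∈ Ici T, HasDerivAt y₃ (1 - γ * y₂ t - y t) t := by
    intro t ht
    refine (hy.deriv_three t).congr_deriv ?_
    rw [max_eq_left (hT t ht), max_eq_right (by linarith [hT t ht])]
    ring
  have hα := hp.α_sq
  have hsum := hp.α_sq_add_ω_sq
  have hdamp : ∀ μ : ℝ, 4 * μ ^ 2 = 2 - γ → ∃ C S : ℝ, ∀ t ∈ Ici T,
      Real.exp (-μ * t) * (y₂ t + 2 * μ * y₁ t + (y t - 1)) =
        C * Real.cos (ω * t) + S * Real.sin (ω * t) ∧
      Real.exp (-μ * t) * ((y₃ t + 2 * μ * y₂ t + y₁ t) + -μ * (y₂ t + 2 * μ * y₁ t + (y t - 1))) =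
        ω * (S * Real.cos (ω * t) - C * Real.sin (ω * t)) := by
    intro μ hμ
    refine exists_exp_mul_eq_cos_add_sin (x := fun t => y₂ t + 2 * μ * y₁ t + (y t - 1))
      (x₁ := fun t => y₃ t + 2 * μ * y₂ t + y₁ t)
      hp.ω_pos.ne' (by nlinarith) (convex_Ici T) (fun t ht => ?_) (fun t ht => ?_)
    · exact ((hy.deriv_two t).add ((hy.deriv_one t).const_mul (2 * μ))).add
        ((hy.deriv_zero t).sub_const 1)
    · refine (((heq t ht).add ((hy.deriv_two t).const_mul (2 * μ))).add
        (hy.deriv_one t)).congr_deriv ?_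
      linear_combination (-y₂ t) * hμ
  obtain ⟨C, S, hf⟩ := hdamp α hα
  obtain ⟨C', S', hg⟩ := hdamp (-α) (by rw [neg_sq]; exact hα)
  have hexp : Tendsto (fun t => Real.exp (-(α * t))) atTop (𝓝 0) :=
    Real.tendsto_exp_neg_atTop_nhds_zero.comp (tendsto_id.const_mul_atTop hp.α_pos)
  have hbdd : ∀ C S : ℝ, ∀ t, ‖C * Real.cos (ω * t) + S * Real.sin (ω * t)‖ ≤ |C| + |S| := by
    intro C S t
    refine (norm_add_le _ _).trans (add_le_add ?_ ?_)
    · rw [norm_mul]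
      exact mul_le_of_le_one_right (norm_nonneg _) (Real.abs_cos_le_one _)
    · rw [norm_mul]
      exact mul_le_of_le_one_right (norm_nonneg _) (Real.abs_sin_le_one _)
  have hg0 : Tendsto (fun t => y₂ t + 2 * (-α) * y₁ t + (y t - 1)) atTop (𝓝 0) := by
    have h0 : Tendsto (fun t => Real.exp (-(α * t)) *
        (C' * Real.cos (ω * t) + S' * Real.sin (ω * t))) atTop (𝓝 0) :=
      hexp.zero_mul_isBoundedUnder_le (isBoundedUnder_of ⟨_, hbdd C' S'⟩)
    refine h0.congr' ?_
    filter_upwards [Ici_mem_atTop T] with t ht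
    rw [← (hg t ht).1, ← mul_assoc, ← Real.exp_add]
    simp
  have hf0 : Tendsto (fun t => y₂ t + 2 * α * y₁ t + (y t - 1)) atTop (𝓝 0) := by
    have := hg0.add (hy.tendsto_slope.const_mul (4 * α))
    simp only [mul_zero, add_zero] at this
    refine this.congr fun t => ?_
    ring
  have hCS : C = 0 ∧ S = 0 := by
    refine eq_zero_of_tendsto_cos_add_sin hp.ω_pos ?_
    have := hexp.mul hf0
    rw [mul_zero] at this
    refine this.congr' ?_
    filter_upwards [Ici_mem_atTop T] with t ht
    rw [← (hf t ht).1, neg_mul]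
  intro t ht
  obtain ⟨h1, h2⟩ := hf t ht
  rw [hCS.1, hCS.2] at h1 h2
  have hne := (Real.exp_pos (-α * t)).ne'
  have h1' : y₂ t + 2 * α * y₁ t + (y t - 1) = 0 := by simpa [hne] using h1
  rw [h1'] at h2
  exact ⟨h1', by simpa [hne] using h2⟩

/-- A profile that stays nonnegative is the equilibrium. -/
theorem eq_one_of_nonneg (hy : IsHomoclinicProfile γ β y y₁ y₂ y₃)
    (hp : IsSpectralData γ β p q α ω) (h0 : ∀ t, 0 ≤ y t) (t : ℝ) : y t = 1 := by
  have h1 : ∀ t, y₁ t = 0 := by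
    intro t
    -- Reflection turns the stable equation into the unstable one; their difference is `4 α y′`.
    have e1 := (hy.stable hp (T := t) (fun s _ => h0 s) t self_mem_Ici).1
    have e2 := (hy.stable hp (T := -t) (fun s _ => h0 s) (-t) self_mem_Ici).1
    rw [hy.even, hy.odd_deriv, hy.even_deriv_two] at e2
    have : α * y₁ t = 0 := by linarith
    exact (mul_eq_zero.1 this).resolve_left hp.α_pos.ne'
  have h2 : y₂ t = 0 := by
    have := hy.deriv_one t
    rw [show y₁ = fun _ => 0 from funext h1] at this
    exact this.unique (hasDerivAt_const _ _)
  have e := (hy.stable hp (T := t) (fun s _ => h0 s) t self_mem_Ici).1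
  rw [h1, h2] at e
  linarith

/-- The damped oscillator `y - 1` is evaluated a phase `5π/4` after the last zero `T`, close to its
next minimum. As `y` is still positive there, its slope at `T` is not too large. -/
theorem slope_lt (hy : IsHomoclinicProfile γ β y y₁ y₂ y₃) (hp : IsSpectralData γ β p q α ω) {T : ℝ}
    (hT0 : y T = 0) (hT : ∀ t, T < t → 0 < y t) :
    y₁ T - α < ω * (1 + √2 * Real.exp (5 * Real.pi / 4 * (α / ω))) := by
  have hω := hp.ω_pos
  have hT' : ∀ t ∈ Ici T, 0 ≤ y t := by
    intro t ht
    rcases eq_or_lt_of_le (show T ≤ t from ht) with rfl | h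
    · exact hT0.ge
    · exact (hT t h).le
  have hst := hy.stable hp hT'
  obtain ⟨C, S, hCS⟩ := exists_exp_mul_eq_cos_add_sin (x := fun t => y t - 1) (x₁ := y₁) (μ := α)
    hω.ne' hp.α_sq_add_ω_sq (convex_Ici T) (fun t _ => (hy.deriv_zero t).sub_const 1)
    (fun t ht => (hy.deriv_one t).congr_deriv (by linarith [(hst t ht).1]))
  set τ := 5 * Real.pi / 4 / ω with hτ
  have hτ0 : 0 < τ := by have := Real.pi_pos; positivity
  obtain ⟨a1, a2⟩ := hCS T self_mem_Ici
  obtain ⟨b1, -⟩ := hCS (T + τ) (by simp [hτ0.le])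
  have hpos := hT (T + τ) (by linarith)
  have hc : Real.cos (ω * τ) = -(√2 / 2) := by
    rw [show ω * τ = Real.pi / 4 + Real.pi by rw [hτ]; field_simp; ring, Real.cos_add_pi,
      Real.cos_pi_div_four]
  have hs : Real.sin (ω * τ) = -(√2 / 2) := by
    rw [show ω * τ = Real.pi / 4 + Real.pi by rw [hτ]; field_simp; ring, Real.sin_add_pi,
      Real.sin_pi_div_four]
  rw [mul_add ω, Real.cos_add, Real.sin_add, hc, hs, mul_add α, Real.exp_add,
    show α * τ = 5 * Real.pi / 4 * (α / ω) by rw [hτ]; ring] at b1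
  simp only [hT0] at a1 a2
  have he := Real.exp_pos (α * T)
  have he2 := Real.exp_pos (5 * Real.pi / 4 * (α / ω))
  set e := Real.exp (α * T)
  set e2 := Real.exp (5 * Real.pi / 4 * (α / ω))
  have h2 : √2 * √2 = 2 := Real.mul_self_sqrt (by norm_num)
  have h20 : 0 < √2 := by positivity
  have b2 : ω * (e2 * (y (T + τ) - 1)) = √2 / 2 * (ω - (y₁ T - α)) := by
    have : e * (ω * (e2 * (y (T + τ) - 1))) = e * (√2 / 2 * (ω - (y₁ T - α))) := by
      linear_combination ω * b1 + (√2 / 2) * ω * a1 + (√2 / 2) * a2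
    exact mul_left_cancel₀ he.ne' this
  have b3 : -(ω * e2) < √2 / 2 * (ω - (y₁ T - α)) := by
    rw [← b2]
    have : 0 < ω * (e2 * y (T + τ)) := by positivity
    linarith
  have b4 : √2 * -(ω * e2) < √2 * (√2 / 2 * (ω - (y₁ T - α))) :=
    mul_lt_mul_of_pos_left b3 h20
  have b5 : √2 * (√2 / 2 * (ω - (y₁ T - α))) = ω - (y₁ T - α) := by
    linear_combination ((ω - (y₁ T - α)) / 2) * h2
  rw [b5] at b4
  linarith

end IsHomoclinicProfile

/-! ### The trough -/

namespace IsHomoclinicProfile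

theorem continuous (hy : IsHomoclinicProfile γ β y y₁ y₂ y₃) : Continuous y :=
  continuous_iff_continuousAt.2 fun t => (hy.deriv_zero t).continuousAt

theorem exists_trough (hy : IsHomoclinicProfile γ β y y₁ y₂ y₃) (hp : IsSpectralData γ β p q α ω)
    (h2 : {t | y t = 0}.encard = 2) :
    ∃ T, 0 < T ∧ y T = 0 ∧ (∀ t, T < t → 0 < y t) ∧ ∀ t ∈ Icc (-T) T, y t ≤ 0 := by
  obtain ⟨T, hT, hzero⟩ : ∃ T, 0 < T ∧ ∀ t, y t = 0 ↔ t = T ∨ t = -T := by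
    obtain ⟨a, b, hab, hS⟩ := encard_eq_two.1 h2
    have hmem : ∀ t, y t = 0 ↔ t = a ∨ t = b := fun t => by
      have := Set.ext_iff.1 hS t
      simpa using this
    have hna := (hmem (-a)).1 (by rw [hy.even]; exact (hmem a).2 (Or.inl rfl))
    have hnb := (hmem (-b)).1 (by rw [hy.even]; exact (hmem b).2 (Or.inr rfl))
    have hb : b = -a := by
      rcases hna with h | h
      · rcases hnb with h' | h'
        · linarith
        · exact absurd (show a = b by linarith) hab
      · exact h.symm
    have ha : a ≠ 0 := fun h => hab (by rw [hb, h, neg_zero])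
    rcases lt_or_gt_of_ne ha with h | h
    · exact ⟨-a, by linarith, fun t => by rw [hmem, hb, neg_neg, or_comm]⟩
    · exact ⟨a, h, fun t => by rw [hmem, hb]⟩
  have hyT : y T = 0 := (hzero T).2 (Or.inl rfl)
  have hout : ∀ t, T < t → 0 < y t := by
    intro t ht
    by_contra! hle
    obtain ⟨t', hpos, htt'⟩ := ((hy.tendsto_value.eventually_const_lt one_pos).and
      (eventually_ge_atTop t)).exists
    obtain ⟨x, hx, hx0⟩ := intermediate_value_Icc htt' hy.continuous.continuousOn ⟨hle, hpos.le⟩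
    rcases (hzero x).1 hx0 with rfl | rfl <;> linarith [hx.1]
  refine ⟨T, hT, hyT, hout, ?_⟩
  by_contra! hcon
  obtain ⟨u, hu, hu0⟩ := hcon
  have hin : ∀ t ∈ Icc (-T) T, 0 ≤ y t := by
    intro t ht
    by_contra! hlt
    have hne : ∀ x ∈ Ioo (-T) T, y x ≠ 0 := by
      intro x hx h0
      rcases (hzero x).1 h0 with rfl | rfl
      · exact lt_irrefl _ hx.2
      · exact lt_irrefl _ hx.1
    have hmem : ∀ x ∈ Icc (-T) T, y x ≠ 0 → x ∈ Ioo (-T) T := by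
      intro x hx h0
      refine ⟨lt_of_le_of_ne hx.1 fun h => h0 ?_, lt_of_le_of_ne hx.2 fun h => h0 ?_⟩
      · exact (hzero x).2 (Or.inr h.symm)
      · exact (hzero x).2 (Or.inl h)
    obtain ⟨x, hx, hx0⟩ := isPreconnected_Ioo.intermediate_value (hmem t ht hlt.ne)
      (hmem u hu hu0.ne') hy.continuous.continuousOn ⟨hlt.le, hu0.le⟩
    exact hne x hx hx0
  -- A profile that touches `0` from above would solve the linear equation of the tail everywhere.
  have hall : ∀ t, 0 ≤ y t := by
    intro t
    by_cases h1 : T < t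
    · exact (hout t h1).le
    by_cases h3 : T < -t
    · rw [← hy.even]; exact (hout _ h3).le
    · exact hin t ⟨by linarith, by linarith⟩
  have := hy.eq_one_of_nonneg hp hall T
  linarith

/-- In the trough each of the two frequencies is carried by an oscillator of its own. -/
theorem exists_mode (hy : IsHomoclinicProfile γ β y y₁ y₂ y₃) {k l T : ℝ} (hk : k ≠ 0)
    (hadd : k ^ 2 + l ^ 2 = γ) (hmul : k ^ 2 * l ^ 2 = β) (hT : 0 < T)
    (hneg : ∀ t ∈ Icc (-T) T, y t ≤ 0) :
    ∃ M, ∀ t ∈ Icc (-T) T, y₂ t + l ^ 2 * y t - 1 / k ^ 2 = M * Real.cos (k * t) ∧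
      y₃ t + l ^ 2 * y₁ t = -(M * k * Real.sin (k * t)) := by
  obtain ⟨C, S, h⟩ := exists_eq_cos_add_sin (x := fun t => y₂ t + l ^ 2 * y t - 1 / k ^ 2)
    (x₁ := fun t => y₃ t + l ^ 2 * y₁ t) hk (convex_Icc (-T) T)
    (fun t _ => ((hy.deriv_two t).add ((hy.deriv_zero t).const_mul _)).sub_const _)
    (fun t ht => ((hy.deriv_three t).add ((hy.deriv_one t).const_mul _)).congr_deriv (by
      have h0 := hneg t ht
      rw [max_eq_right h0, max_eq_left (by linarith)]
      field_simp
      rw [← hadd, ← hmul]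
      ring))
  have h0 := (h 0 ⟨by linarith, hT.le⟩).2
  have hodd : ∀ {f : ℝ → ℝ}, Function.Odd f → f 0 = 0 := fun {f} hf => by
    have := hf 0
    rw [neg_zero] at this
    linarith
  rw [hodd hy.odd_deriv, hodd hy.odd_deriv_three] at h0
  have hS : S = 0 := by simpa [hk] using h0
  refine ⟨C, fun t ht => ?_⟩
  obtain ⟨h1, h2⟩ := h t ht
  rw [h1, h2, hS]
  constructor <;> ring

end IsHomoclinicProfile

/-- The argument of `(1 + i k s) / (1 - k² + 2 α i k)`, the second factor being the value at `i k` of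
the characteristic polynomial `λ² + 2 α λ + 1` of the tail, whose modulus is `√(1 - β)`. Modulo `π`
this is the phase with which the mode of frequency `k` leaves the trough at slope `s`. -/
noncomputable def exitPhase (β k s : ℝ) : ℝ :=
  Real.arctan (k * s) - Real.arccos ((1 - k ^ 2) / √(1 - β))

theorem exitPhase_polar {k l : ℝ} (hk : 0 < k) (hadd : k ^ 2 + l ^ 2 = γ)
    (hmul : k ^ 2 * l ^ 2 = β) (hα : 0 < α) (hαγ : 4 * α ^ 2 = 2 - γ) (hβ : β < 1) (s : ℝ) :
    ∃ R, 0 < R ∧ R ^ 2 = (1 - β) * (1 + (k * s) ^ 2) ∧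
      R * Real.cos (exitPhase β k s) = (1 - k ^ 2) + 2 * α * k ^ 2 * s ∧
      R * Real.sin (exitPhase β k s) = k * ((1 - k ^ 2) * s - 2 * α) := by
  have hρ := Real.sqrt_pos.2 (sub_pos.2 hβ)
  have hρ2 := Real.sq_sqrt (sub_pos.2 hβ).le
  have hr : 0 < √(1 + (k * s) ^ 2) := by positivity
  have hr2 := Real.sq_sqrt (show 0 ≤ 1 + (k * s) ^ 2 by positivity)
  have hid : (1 - k ^ 2) ^ 2 + (2 * α * k) ^ 2 = 1 - β := by
    rw [← hmul]
    linear_combination k ^ 2 * hαγ + k ^ 2 * hadd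
  unfold exitPhase
  set ρ := √(1 - β)
  have hx2 : ((1 - k ^ 2) / ρ) ^ 2 ≤ 1 := by
    rw [div_pow, div_le_one (by positivity), hρ2, ← hid]
    nlinarith [sq_nonneg (2 * α * k)]
  have hx := abs_le.1 ((sq_le_one_iff_abs_le_one _).1 hx2)
  have hcos := Real.cos_arccos hx.1 hx.2
  have hsin : Real.sin (Real.arccos ((1 - k ^ 2) / ρ)) = 2 * α * k / ρ := by
    rw [Real.sin_arccos]
    have : 1 - ((1 - k ^ 2) / ρ) ^ 2 = (2 * α * k / ρ) ^ 2 := by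
      field_simp
      linear_combination hρ2 - hid
    rw [this, Real.sqrt_sq (by positivity)]
  refine ⟨ρ * √(1 + (k * s) ^ 2), by positivity, by rw [mul_pow, hρ2, hr2], ?_, ?_⟩
  · rw [Real.cos_sub, Real.cos_arctan, Real.sin_arctan, hcos, hsin]
    field_simp
  · rw [Real.sin_sub, Real.cos_arctan, Real.sin_arctan, hcos, hsin]
    field_simp

/-- For slopes `s ≥ 0` the two phases advance at different rates, so a phase condition at both
frequencies determines the slope. -/
theorem exitPhase_div_sub_lt (hp : 0 < p) (hpq : p < q) {s s' : ℝ} (hs : 0 ≤ s) (hss : s < s') :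
    exitPhase β p s / p - exitPhase β q s / q < exitPhase β p s' / p - exitPhase β q s' / q := by
  have hq := hp.trans hpq
  have hd : ∀ k : ℝ, 0 < k → ∀ x, HasDerivAt (fun x => Real.arctan (k * x) / k)
      (1 / (1 + (k * x) ^ 2)) x := by
    intro k hk x
    refine ((((hasDerivAt_id' x).const_mul k).arctan).div_const k).congr_deriv ?_
    field_simp
  have hmono : StrictMonoOn (fun x => Real.arctan (p * x) / p - Real.arctan (q * x) / q) (Ici 0) := by
    refine strictMonoOn_of_deriv_pos (convex_Ici 0) (fun x _ =>
      ((hd p hp x).sub (hd q hq x)).continuousAt.continuousWithinAt) fun x hx => ?_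
    rw [interior_Ici] at hx
    have hx0 : 0 < x := hx
    have := ((hd p hp x).sub (hd q hq x)).deriv
    rw [show (fun x => Real.arctan (p * x) / p - Real.arctan (q * x) / q) =
      (fun x => Real.arctan (p * x) / p) - (fun x => Real.arctan (q * x) / q) from rfl, this, sub_pos]
    have h1 : p * x < q * x := mul_lt_mul_of_pos_right hpq hx0
    have h2 : 0 < p * x := mul_pos hp hx0
    apply one_div_lt_one_div_of_lt (by positivity)
    nlinarith
  have := hmono (mem_Ici.2 hs) (mem_Ici.2 (hs.trans hss.le)) hss
  simp only at this
  simp only [exitPhase, sub_div]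
  linarith

/-- The slope `s` at the edge `T` of the trough and the phase conditions at the two frequencies. -/
structure IsTroughEdge (β p q s T : ℝ) (n : ℤ) : Prop where
  slope_pos : 0 < s
  edge_pos : 0 < T
  phase_p : p * T = exitPhase β p s
  phase_q : q * T = exitPhase β q s + n * Real.pi

theorem IsTroughEdge.unique (hp : 0 < p) (hpq : p < q) {s s' T T' : ℝ} {n : ℤ}
    (h : IsTroughEdge β p q s T n) (h' : IsTroughEdge β p q s' T' n) : s = s' ∧ T = T' := by
  have hq := hp.trans hpq
  have key : ∀ {s T : ℝ}, IsTroughEdge β p q s T n →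
      exitPhase β p s / p - exitPhase β q s / q = n * Real.pi / q := by
    intro s T h
    rw [← h.phase_p, eq_sub_of_add_eq h.phase_q.symm]
    field_simp
    ring
  have hs : s = s' := by
    rcases lt_trichotomy s s' with hlt | heq | hgt
    · exact absurd ((key h).trans (key h').symm) (exitPhase_div_sub_lt hp hpq h.slope_pos.le hlt).ne
    · exact heq
    · exact absurd ((key h').trans (key h).symm) (exitPhase_div_sub_lt hp hpq h'.slope_pos.le hgt).ne
  refine ⟨hs, mul_left_cancel₀ hp.ne' ?_⟩
  rw [h.phase_p, h'.phase_p, hs]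

namespace IsHomoclinicProfile

/-- At the edge of the trough the mode of frequency `k` has the opposite of the phase
`exitPhase β k s`. -/
theorem exists_mode_polar (hy : IsHomoclinicProfile γ β y y₁ y₂ y₃) {k l T : ℝ} (hk : 0 < k)
    (hadd : k ^ 2 + l ^ 2 = γ) (hmul : k ^ 2 * l ^ 2 = β) (hα0 : 0 < α)
    (hα : 4 * α ^ 2 = 2 - γ) (hβ : β < 1) (hT : 0 < T) (hyT : y T = 0)
    (hin : ∀ t ∈ Icc (-T) T, y t ≤ 0) (e2 : y₂ T + 2 * α * y₁ T + (y T - 1) = 0)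
    (e3 : y₃ T + 2 * α * y₂ T + y₁ T = 0) :
    ∃ M R, 0 < R ∧ (∀ t ∈ Icc (-T) T, y₂ t + l ^ 2 * y t - 1 / k ^ 2 = M * Real.cos (k * t)) ∧
      R ^ 2 = (1 - β) * (1 + (k * y₁ T) ^ 2) ∧
      M * k ^ 2 * Real.cos (k * T) = -(R * Real.cos (exitPhase β k (y₁ T))) ∧
      M * k ^ 2 * Real.sin (k * T) = -(R * Real.sin (exitPhase β k (y₁ T))) := by
  obtain ⟨M, hM⟩ := hy.exists_mode hk.ne' hadd hmul hT hin
  obtain ⟨R, hR, hR2, hc, hsn⟩ := exitPhase_polar hk hadd hmul hα0 hα hβ (y₁ T)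
  obtain ⟨m1, m2⟩ := hM T ⟨by linarith, le_rfl⟩
  rw [hyT] at m1 e2
  refine ⟨M, R, hR, fun t ht => (hM t ht).1, hR2, ?_, ?_⟩
  · rw [hc]
    have : k ^ 2 * (1 / k ^ 2) = 1 := by field_simp
    linear_combination (-k ^ 2) * m1 + k ^ 2 * e2 - this
  · rw [hsn]
    linear_combination k * m2 - k * e3 + 2 * α * k * e2 - k * y₁ T * hα - k * y₁ T * hadd

end IsHomoclinicProfile

theorem sin_sub_eq_zero_of_polar {m R u v : ℝ} (hR : 0 < R) (hc : m * Real.cos u = -(R * Real.cos v))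
    (hs : m * Real.sin u = -(R * Real.sin v)) :
    m ^ 2 = R ^ 2 ∧ Real.sin (u - v) = 0 ∧ m * Real.cos (u - v) = -R := by
  have t1 := Real.sin_sq_add_cos_sq u
  have t2 := Real.sin_sq_add_cos_sq v
  rw [Real.sin_sub, Real.cos_sub]
  have hsq : m ^ 2 = R ^ 2 := by
    linear_combination (m * Real.cos u - R * Real.cos v) * hc +
      (m * Real.sin u - R * Real.sin v) * hs - m ^ 2 * t1 + R ^ 2 * t2
  refine ⟨hsq, ?_, by linear_combination Real.cos v * hc + Real.sin v * hs - R * t2⟩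
  have hne : m ≠ 0 := by
    rintro rfl
    nlinarith
  refine (mul_eq_zero.1 (?_ : m * _ = 0)).resolve_left hne
  linear_combination Real.cos v * hs - Real.sin v * hc

namespace IsHomoclinicProfile

/-- Inside the trough the profile is `1/β` plus a mode of frequency `p` and one of frequency `q`.
The former dominates, which forces its sign and leaves it less than half a period. -/
theorem exists_isTroughEdge (hy : IsHomoclinicProfile γ β y y₁ y₂ y₃)
    (hp : IsSpectralData γ β p q α ω) {T : ℝ} (hT : 0 < T) (hyT : y T = 0)
    (hout : ∀ t, T < t → 0 < y t) (hin : ∀ t ∈ Icc (-T) T, y t ≤ 0) :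
    ∃ n, IsTroughEdge β p q (y₁ T) T n := by
  have hpp := hp.p_pos
  have hq := hp.q_pos
  have hα := hp.α_sq
  have hβ := hp.β_lt_one
  have hd := sub_pos.2 hp.sq_lt_sq
  obtain ⟨e2, e3⟩ := hy.stable hp (T := T) (fun t ht => by
    rcases eq_or_lt_of_le (show T ≤ t from ht) with rfl | h
    · exact hyT.ge
    · exact (hout t h).le) T self_mem_Ici
  obtain ⟨P, R, hR, hmP, hR2, hPc, hPs⟩ := hy.exists_mode_polar hpp hp.add_sq hp.mul_sq
    hp.α_pos hα hβ hT hyT hin e2 e3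
  obtain ⟨Q, R', hR', hmQ, hR2', hQc, hQs⟩ := hy.exists_mode_polar hq
    (by rw [add_comm, hp.add_sq]) (by rw [mul_comm, hp.mul_sq]) hp.α_pos hα hβ hT hyT hin e2 e3
  set s := y₁ T with hs
  obtain ⟨hP2, hP0, hP1⟩ := sin_sub_eq_zero_of_polar hR hPc hPs
  obtain ⟨hQ2, hQ0, -⟩ := sin_sub_eq_zero_of_polar hR' hQc hQs
  -- The low frequency dominates.
  have hPQ : Q ^ 2 < P ^ 2 := by
    have f1 : P ^ 2 * p ^ 4 = (1 - β) * (1 + (p * s) ^ 2) := by rw [← hR2, ← hP2]; ring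
    have f2 : Q ^ 2 * q ^ 4 = (1 - β) * (1 + (q * s) ^ 2) := by rw [← hR2', ← hQ2]; ring
    have hb := sub_pos.2 hβ
    have hp4 : 0 < p ^ 4 := by positivity
    have hq4 : 0 < q ^ 4 := by positivity
    have f3 : Q ^ 2 * (p ^ 4 * q ^ 4) < P ^ 2 * (p ^ 4 * q ^ 4) := by
      have g1 : P ^ 2 * (p ^ 4 * q ^ 4) - Q ^ 2 * (p ^ 4 * q ^ 4) =
          (1 - β) * ((q ^ 2 - p ^ 2) * ((q ^ 2 + p ^ 2) + s ^ 2 * (p ^ 2 * q ^ 2))) := by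
        linear_combination q ^ 4 * f1 - p ^ 4 * f2
      have : 0 < (1 - β) * ((q ^ 2 - p ^ 2) * ((q ^ 2 + p ^ 2) + s ^ 2 * (p ^ 2 * q ^ 2))) := by
        positivity
      linarith
    exact lt_of_mul_lt_mul_right f3 (by positivity)
  have hrep : ∀ t ∈ Icc (-T) T, (q ^ 2 - p ^ 2) * y t =
      P * Real.cos (p * t) - Q * Real.cos (q * t) + (1 / p ^ 2 - 1 / q ^ 2) := by
    intro t ht
    linear_combination hmP t ht - hmQ t ht
  have hinv : 0 < 1 / p ^ 2 - 1 / q ^ 2 :=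
    sub_pos.2 (one_div_lt_one_div_of_lt (by positivity) hp.sq_lt_sq)
  have hPneg : P < 0 := by
    have h0 := hrep 0 ⟨by linarith, hT.le⟩
    simp only [mul_zero, Real.cos_zero, mul_one] at h0
    have h1 : (q ^ 2 - p ^ 2) * y 0 ≤ 0 :=
      mul_nonpos_of_nonneg_of_nonpos hd.le (hin 0 ⟨by linarith, hT.le⟩)
    by_contra! hc
    have := abs_lt_of_sq_lt_sq hPQ hc
    linarith [(abs_lt.1 this).2]
  -- The mode of frequency `p` cannot reach its maximum inside the trough.
  have hpT : p * T < Real.pi := by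
    by_contra! hc
    have hmem : Real.pi / p ∈ Icc (-T) T :=
      ⟨by have : 0 < Real.pi / p := by positivity
          linarith, by rw [div_le_iff₀ hpp]; linarith⟩
    have h0 := hrep _ hmem
    rw [mul_div_cancel₀ _ hpp.ne', Real.cos_pi] at h0
    have h1 : (q ^ 2 - p ^ 2) * y (Real.pi / p) ≤ 0 :=
      mul_nonpos_of_nonneg_of_nonpos hd.le (hin _ hmem)
    have h2 : |Q| < -P := abs_lt_of_sq_lt_sq (by rwa [neg_sq]) (by linarith)
    have h3 : Q * Real.cos (q * (Real.pi / p)) ≤ |Q| := by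
      refine (le_abs_self _).trans ?_
      rw [abs_mul]
      exact mul_le_of_le_one_right (abs_nonneg _) (Real.abs_cos_le_one _)
    linarith
  have hphase : p * T = exitPhase β p s := by
    have hpos : 0 < Real.cos (p * T - exitPhase β p s) := by
      by_contra! hc
      have : 0 ≤ P * p ^ 2 * Real.cos (p * T - exitPhase β p s) :=
        mul_nonneg_of_nonpos_of_nonpos (mul_nonpos_of_nonpos_of_nonneg hPneg.le (by positivity)) hc
      linarith
    have hlo : -Real.pi < p * T - exitPhase β p s := by
      have := Real.arctan_lt_pi_div_two (p * s)
      have := Real.arccos_nonneg ((1 - p ^ 2) / √(1 - β))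
      have : 0 < p * T := by positivity
      unfold exitPhase
      linarith [Real.pi_pos]
    have hhi : p * T - exitPhase β p s < 2 * Real.pi := by
      have := Real.neg_pi_div_two_lt_arctan (p * s)
      have : Real.arccos ((1 - p ^ 2) / √(1 - β)) ≤ Real.pi / 2 := by
        rw [Real.arccos_le_pi_div_two]
        have := hp.p_lt_one
        exact div_nonneg (by nlinarith) (Real.sqrt_nonneg _)
      unfold exitPhase
      linarith
    obtain ⟨n, hn⟩ := Real.sin_eq_zero_iff.1 hP0
    rw [← hn] at hlo hhi hpos
    have n1 : -1 < n := by
      have : (-1 : ℝ) < n := lt_of_mul_lt_mul_right (by linarith) Real.pi_pos.le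
      exact_mod_cast this
    have n2 : n < 2 := by
      have : (n : ℝ) < 2 := lt_of_mul_lt_mul_right hhi Real.pi_pos.le
      exact_mod_cast this
    obtain rfl | rfl : n = 0 ∨ n = 1 := by omega
    · simp only [Int.cast_zero, zero_mul] at hn
      linarith
    · norm_num at hpos
  obtain ⟨n, hn⟩ := Real.sin_eq_zero_iff.1 hQ0
  refine ⟨n, ?_, hT, hphase, by linarith⟩
  have h1 : 0 < Real.arctan (p * s) := by
    have : 0 < p * T := by positivity
    rw [hphase, exitPhase] at this
    linarith [Real.arccos_nonneg ((1 - p ^ 2) / √(1 - β))]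
  rw [Real.arctan_pos] at h1
  exact (pos_iff_pos_of_mul_pos h1).1 hpp

end IsHomoclinicProfile

namespace IsTroughEdge

variable {s T : ℝ} {n : ℤ}

theorem neg_one_lt (hp : IsSpectralData γ β p q α ω) (h : IsTroughEdge β p q s T n) : -1 < n := by
  have h1 := h.phase_q
  have h2 : 0 < q * T := mul_pos hp.q_pos h.edge_pos
  have h3 := Real.arctan_lt_pi_div_two (q * s)
  have h4 := Real.arccos_nonneg ((1 - q ^ 2) / √(1 - β))
  have hpi := Real.pi_pos
  unfold exitPhase at h1
  have : (-1 : ℝ) < n := by nlinarith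
  exact_mod_cast this

/-- Since `x ≤ tan x`, the phase condition at frequency `p` bounds the half-width of the trough. -/
theorem edge_le (hp : IsSpectralData γ β p q α ω) (h : IsTroughEdge β p q s T n) :
    T ≤ s - 2 * α := by
  have hs := h.slope_pos
  have hpp := hp.p_pos
  have hα := hp.α_pos
  have hp1 : 0 < 1 - p ^ 2 := by have := hp.p_lt_one; nlinarith
  obtain ⟨R, hR, -, hc, hsn⟩ := exitPhase_polar hpp hp.add_sq hp.mul_sq hα
    hp.α_sq hp.β_lt_one s
  have hpT : 0 < p * T := mul_pos hpp h.edge_pos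
  have hpT2 : p * T < Real.pi / 2 := by
    rw [h.phase_p, exitPhase]
    linarith [Real.arctan_lt_pi_div_two (p * s), Real.arccos_nonneg ((1 - p ^ 2) / √(1 - β))]
  have hlt := Real.lt_tan hpT hpT2
  have htan : Real.tan (p * T) =
      p * ((1 - p ^ 2) * s - 2 * α) / ((1 - p ^ 2) + 2 * α * p ^ 2 * s) := by
    rw [h.phase_p, Real.tan_eq_sin_div_cos, ← hc, ← hsn, mul_div_mul_left _ _ hR.ne']
  have hW : 0 < (1 - p ^ 2) + 2 * α * p ^ 2 * s := by positivity
  have hα1 : α ^ 2 < 1 := by nlinarith [hp.α_sq_add_ω_sq, hp.ω_pos]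
  rw [htan, lt_div_iff₀ hW] at hlt
  have h1 : T * ((1 - p ^ 2) + 2 * α * p ^ 2 * s) < (1 - p ^ 2) * s - 2 * α := by
    refine lt_of_mul_lt_mul_left ?_ hpp.le
    linarith
  have h2 : (1 - p ^ 2) * s - 2 * α ≤ (s - 2 * α) * ((1 - p ^ 2) + 2 * α * p ^ 2 * s) := by
    have h3 : 0 ≤ 1 + s ^ 2 - 2 * α * s := by nlinarith [sq_nonneg (s - α)]
    have h4 : 0 ≤ 2 * α * p ^ 2 * (1 + s ^ 2 - 2 * α * s) := by positivity
    linarith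
  exact (lt_of_mul_lt_mul_right (h1.trans_le h2) hW.le).le

end IsTroughEdge

/-! ### Numerical bound on the phase -/

/-- Tangent-line bound for the concave function `5πr/2 + log (1 - r²) - 2 log (1 + r²)` at
`r = 0.85`, close to its maximum. -/
theorem exp_mul_one_sub_sq_le {r : ℝ} (h0 : 0 < r) (h1 : r < 1) :
    Real.exp (5 * Real.pi / 2 * r) * (1 - r ^ 2) ≤ 82.8 * (1 + r ^ 2) ^ 2 := by
  have hπ2 := Real.pi_lt_d4
  have hr : 0 < 1 - r ^ 2 := by nlinarith
  -- The quartic is positive, with a minimum of about `0.03` near `r = 0.807`.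
  have hpoly : 2 * (0.7225 - r ^ 2) ≤
      (6.7 - 7.854 * r - (0.7225 - r ^ 2) / 0.2775) * (1 + r ^ 2) := by
    have : (6.7 - 7.854 * r - (0.7225 - r ^ 2) / 0.2775) * (1 + r ^ 2) - 2 * (0.7225 - r ^ 2) =
        1 / 0.2775 * (r ^ 2 - 1.0897425 * r + 0.2283) ^ 2 + 3.77 * (r - 0.803) ^ 2 +
          (9.7 - 1 / 0.2775 * (1.0897425 ^ 2 + 2 * 0.2283) - 3.77) * r ^ 2 +
          (2 / 0.2775 * 0.2283 * 1.0897425 + 2 * 3.77 * 0.803 - 7.854) * r +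
          (58861 / 22200 - 0.2283 ^ 2 / 0.2775 - 3.77 * 0.803 ^ 2) := by
      ring
    have c1 : 0 ≤ 1 / 0.2775 * (r ^ 2 - 1.0897425 * r + 0.2283) ^ 2 := by positivity
    have c2 : 0 ≤ 3.77 * (r - 0.803) ^ 2 := by positivity
    have c3 : 0 ≤ r ^ 2 := by positivity
    norm_num at this c1 c2 ⊢
    linarith
  have a1 : (1 - r ^ 2) / 0.2775 ≤ Real.exp ((0.7225 - r ^ 2) / 0.2775) := by
    refine le_trans (le_of_eq ?_) (Real.add_one_le_exp _)
    ring
  have a2 : 1.7225 / (1 + r ^ 2) ≤ Real.exp ((0.7225 - r ^ 2) / (1 + r ^ 2)) := by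
    refine le_trans (le_of_eq ?_) (Real.add_one_le_exp _)
    field_simp
    ring
  have a3 : (1 - r ^ 2) / 0.2775 * (1.7225 / (1 + r ^ 2)) ^ 2 * Real.exp (5 * Real.pi / 2 * r) ≤
      Real.exp ((0.7225 - r ^ 2) / 0.2775 + 2 * ((0.7225 - r ^ 2) / (1 + r ^ 2)) +
        5 * Real.pi / 2 * r) := by
    rw [Real.exp_add, Real.exp_add, two_mul ((0.7225 - r ^ 2) / (1 + r ^ 2)), Real.exp_add, ← pow_two]
    gcongr
  have a4 : (0.7225 - r ^ 2) / 0.2775 + 2 * ((0.7225 - r ^ 2) / (1 + r ^ 2)) +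
      5 * Real.pi / 2 * r ≤ 6.7 := by
    have b1 : 5 * Real.pi / 2 * r ≤ 7.854 * r := by gcongr; linarith
    have b2 : 2 * ((0.7225 - r ^ 2) / (1 + r ^ 2)) ≤ 6.7 - 7.854 * r - (0.7225 - r ^ 2) / 0.2775 := by
      rw [← mul_div_assoc, div_le_iff₀ (by positivity)]
      linarith
    linarith
  have a5 : Real.exp 6.7 ≤ 830 := by
    have b1 : Real.exp 6.7 * Real.exp 0.3 = Real.exp 1 ^ 7 := by
      rw [← Real.exp_add, ← Real.exp_nat_mul]
      norm_num
    have b2 : Real.exp 1 ^ 7 ≤ 1097 := by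
      have := Real.exp_one_lt_d9
      calc Real.exp 1 ^ 7 ≤ 2.7182818286 ^ 7 := by gcongr
        _ ≤ 1097 := by norm_num
    have b3 := Real.quadratic_le_exp_of_nonneg (x := 0.3) (by norm_num)
    have b4 := Real.exp_pos 6.7
    nlinarith
  have a6 := a3.trans ((Real.exp_le_exp.2 a4).trans a5)
  have a7 : (1 - r ^ 2) / 0.2775 * (1.7225 / (1 + r ^ 2)) ^ 2 * Real.exp (5 * Real.pi / 2 * r) =
      Real.exp (5 * Real.pi / 2 * r) * (1 - r ^ 2) * (1.7225 ^ 2 / 0.2775) / (1 + r ^ 2) ^ 2 := by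
    field_simp
  rw [a7, div_le_iff₀ (by positivity)] at a6
  norm_num at a6 ⊢
  nlinarith [sq_nonneg (1 + r ^ 2)]

theorem exp_mul_le_of_one_lt {r γ : ℝ} (h0 : 0 < r) (hr : γ * (1 + r ^ 2) = 2 * (1 - r ^ 2))
    (hγ : 1 < γ) (hγ2 : γ ≤ 3 / 2) : Real.exp (5 * Real.pi / 4 * r) ≤ 9.7 := by
  have hr1 : r ≤ 0.5774 := by nlinarith
  have hπ := Real.pi_lt_d4
  have h1 : 5 * Real.pi / 4 * r ≤ 2.2675 := by nlinarith
  refine (Real.exp_le_exp.2 h1).trans (le_of_pow_le_pow_left₀ (n := 4) (by norm_num) (by norm_num) ?_)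
  have b1 : Real.exp 2.2675 ^ 4 * Real.exp (-0.07) = Real.exp 1 ^ 9 := by
    rw [← Real.exp_nat_mul, ← Real.exp_add, ← Real.exp_nat_mul]
    norm_num
  have b2 : Real.exp 1 ^ 9 ≤ 8104 := by
    have := Real.exp_one_lt_d9
    calc Real.exp 1 ^ 9 ≤ 2.7182818286 ^ 9 := by gcongr
      _ ≤ 8104 := by norm_num
  have b3 := Real.add_one_le_exp (-0.07)
  have b4 : 0 < Real.exp 2.2675 ^ 4 := by positivity
  norm_num at b3 ⊢
  nlinarith

theorem exp_mul_le_of_three_halves_lt {r γ : ℝ} (h0 : 0 < r)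
    (hr : γ * (1 + r ^ 2) = 2 * (1 - r ^ 2)) (hγ : 3 / 2 < γ) :
    Real.exp (5 * Real.pi / 4 * r) ≤ 4.5 := by
  have hr1 : r ≤ 0.378 := by nlinarith
  have hπ := Real.pi_lt_d4
  have h1 : 5 * Real.pi / 4 * r ≤ 3 / 2 := by nlinarith
  refine (Real.exp_le_exp.2 h1).trans (le_of_pow_le_pow_left₀ (n := 2) (by norm_num) (by norm_num) ?_)
  have b1 : Real.exp (3 / 2) ^ 2 = Real.exp 1 ^ 3 := by
    rw [← Real.exp_nat_mul, ← Real.exp_nat_mul]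
    norm_num
  rw [b1]
  have := Real.exp_one_lt_d9
  calc Real.exp 1 ^ 3 ≤ 2.7182818286 ^ 3 := by gcongr
    _ ≤ 4.5 ^ 2 := by norm_num

theorem IsSpectralData.ratio (hp : IsSpectralData γ β p q α ω) :
    γ * (1 + (α / ω) ^ 2) = 2 * (1 - (α / ω) ^ 2) ∧ (q * ω) ^ 2 < γ * ω ^ 2 := by
  have hω := hp.ω_pos
  constructor
  · field_simp
    linear_combination (γ / 4 + 1 / 2) * hp.α_sq + (γ / 4 - 1 / 2) * hp.ω_sq
  · rw [mul_pow]
    gcongr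
    linarith [hp.add_sq, pow_pos hp.p_pos 2]

/-- With `r = α / ω` one has `γ ω² = 2 (1 - r²) / (1 + r²)²`, so that `q < √γ` leaves a function of `r`
alone, with a maximum of about `17.3` near `r = 0.85`. The constant must stay below `6 π - 1 / 17`. -/
theorem slope_bound_of_le_one (hp : IsSpectralData γ β p q α ω) (hγ : γ ≤ 1) :
    q * (ω * (1 + √2 * Real.exp (5 * Real.pi / 4 * (α / ω))) - α) ≤ 18.7 := by
  obtain ⟨hr, hX⟩ := hp.ratio
  have hω := hp.ω_pos
  have hω2 := hp.ω_sq
  have hr0 : 0 < α / ω := div_pos hp.α_pos hω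
  have hX0 : 0 < q * ω := mul_pos hp.q_pos hω
  have hγ0 : 0 < γ := by
    rw [← hp.add_sq]; have := hp.p_pos; positivity
  have hαr : q * (ω * (1 + √2 * Real.exp (5 * Real.pi / 4 * (α / ω))) - α) =
      q * ω * (1 - α / ω) + q * ω * (√2 * Real.exp (5 * Real.pi / 4 * (α / ω))) := by
    field_simp
    ring
  rw [hαr]
  have hωr : ω ^ 2 * (1 + (α / ω) ^ 2) = 1 := by
    field_simp
    linarith [hp.α_sq_add_ω_sq]
  set r := α / ω
  have hr1 : r < 1 := by nlinarith
  have hr2 : 0.57 ≤ r := by nlinarith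
  have hX1 : q * ω ≤ 0.87 := by nlinarith
  have hE := exp_mul_one_sub_sq_le hr0 hr1
  have hE2 : Real.exp (5 * Real.pi / 2 * r) = Real.exp (5 * Real.pi / 4 * r) ^ 2 := by
    rw [← Real.exp_nat_mul]
    congr 1
    push_cast
    ring
  rw [hE2] at hE
  set E := Real.exp (5 * Real.pi / 4 * r)
  have h1 : q * ω * (1 - r) ≤ 0.87 * 0.43 := by
    gcongr
    linarith
  have h2 : q * ω * (√2 * E) ≤ 18.2 := by
    refine le_of_pow_le_pow_left₀ (n := 2) (by norm_num) (by norm_num) ?_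
    rw [mul_pow (q * ω), mul_pow √2, Real.sq_sqrt (by norm_num)]
    have h3 : (q * ω) ^ 2 * (2 * E ^ 2) ≤ γ * ω ^ 2 * (2 * E ^ 2) := by gcongr
    have h4 : γ * ω ^ 2 * (2 * E ^ 2) * (1 + r ^ 2) ^ 2 ≤ 331.2 * (1 + r ^ 2) ^ 2 := by
      have : γ * ω ^ 2 * (2 * E ^ 2) * (1 + r ^ 2) ^ 2 = 4 * (E ^ 2 * (1 - r ^ 2)) := by
        linear_combination 2 * E ^ 2 * (γ * (1 + r ^ 2) * hωr + hr)
      rw [this]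
      linarith
    have h5 := le_of_mul_le_mul_right h4 (by positivity)
    linarith
  linarith

/-- For `γ > 1` the frequency `q` may exceed `1`, and then `φ_q` exceeds `π / 2`. The constant must
stay below `11 π / 2 - 1 / 15`. -/
theorem slope_bound_of_one_lt (hp : IsSpectralData γ β p q α ω) (hγ : 1 < γ) :
    q * (ω * (1 + √2 * Real.exp (5 * Real.pi / 4 * (α / ω))) - α) ≤ 17.2 := by
  obtain ⟨hr, hX⟩ := hp.ratio
  have hω := hp.ω_pos
  have hω2 := hp.ω_sq
  have hr0 : 0 < α / ω := div_pos hp.α_pos hω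
  have hX0 : 0 < q * ω := mul_pos hp.q_pos hω
  have h2 : √2 ≤ 1.4143 := Real.sqrt_le_iff.2 ⟨by norm_num, by norm_num⟩
  have h3 : q * (ω * (1 + √2 * Real.exp (5 * Real.pi / 4 * (α / ω))) - α) ≤
      q * ω * (1 + 1.4143 * Real.exp (5 * Real.pi / 4 * (α / ω))) := by
    have h4 : 0 ≤ q * α := (mul_pos hp.q_pos hp.α_pos).le
    have h5 : q * ω * (1 + √2 * Real.exp (5 * Real.pi / 4 * (α / ω))) ≤
      q * ω * (1 + 1.4143 * Real.exp (5 * Real.pi / 4 * (α / ω))) := by gcongr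
    linarith
  refine h3.trans ?_
  rcases le_or_gt γ (3 / 2) with hγ2 | hγ2
  · have hE := exp_mul_le_of_one_lt hr0 hr hγ hγ2
    have hX1 : q * ω ≤ 1.1458 := by nlinarith
    calc q * ω * (1 + 1.4143 * Real.exp (5 * Real.pi / 4 * (α / ω))) ≤ 1.1458 * (1 + 1.4143 * 9.7) := by gcongr
      _ ≤ 17.2 := by norm_num
  · have hE := exp_mul_le_of_three_halves_lt hr0 hr hγ2
    have hX1 : q * ω ≤ 1.4143 := by nlinarith [hp.γ_lt_two]
    calc q * ω * (1 + 1.4143 * Real.exp (5 * Real.pi / 4 * (α / ω))) ≤ 1.4143 * (1 + 1.4143 * 4.5) := by gcongr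
      _ ≤ 17.2 := by norm_num

theorem pi_div_two_sub_inv_le_arctan {x : ℝ} (hx : 0 < x) :
    Real.pi / 2 - x⁻¹ ≤ Real.arctan x := by
  have h1 := Real.arctan_inv_of_pos hx
  have h2 : Real.arctan x⁻¹ ≤ x⁻¹ := by
    have h3 := Real.le_tan (Real.arctan_nonneg.2 (inv_pos.2 hx).le) (Real.arctan_lt_pi_div_two x⁻¹)
    rwa [Real.tan_arctan] at h3
  linarith

theorem IsTroughEdge.lt_six {s T : ℝ} {n : ℤ} (hp : IsSpectralData γ β p q α ω)
    (h : IsTroughEdge β p q s T n)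
    (hs : s - α < ω * (1 + √2 * Real.exp (5 * Real.pi / 4 * (α / ω)))) : n < 6 := by
  by_contra! hn
  have hπ1 := Real.pi_gt_d4
  have hq := hp.q_pos
  have hα := hp.α_pos
  have hT := h.edge_le hp
  have hn' : (6 : ℝ) ≤ n := by exact_mod_cast hn
  have hnπ : 6 * Real.pi ≤ n * Real.pi := by gcongr
  have hqT := h.phase_q
  unfold exitPhase at hqT
  have hqs : q * T ≤ q * s := by gcongr; linarith
  have hqs' : q * T < q * (ω * (1 + √2 * Real.exp (5 * Real.pi / 4 * (α / ω))) - α) := by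
    gcongr; linarith
  have hat : 0 ≤ Real.arctan (q * s) :=
    Real.arctan_nonneg.2 (mul_pos hq h.slope_pos).le
  have harc : ∀ x : ℝ, 0 < x → x ≤ q * s → Real.pi / 2 - x⁻¹ ≤ Real.arctan (q * s) := fun x hx hle =>
    (pi_div_two_sub_inv_le_arctan hx).trans (Real.arctan_mono hle)
  rcases le_or_gt γ 1 with hγ | hγ
  · have hb := slope_bound_of_le_one hp hγ
    have hφ : Real.arccos ((1 - q ^ 2) / √(1 - β)) ≤ Real.pi / 2 := by
      rw [Real.arccos_le_pi_div_two]
      exact div_nonneg (by nlinarith [hp.add_sq, hp.p_pos]) (Real.sqrt_nonneg _)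
    -- A first bound `17 ≤ q s` makes `arctan (q s)` almost `π / 2`, which improves the bound on `q T`.
    have := harc 17 (by norm_num) (by linarith)
    norm_num at this hb
    linarith
  · have hb := slope_bound_of_one_lt hp hγ
    have hφ := Real.arccos_le_pi ((1 - q ^ 2) / √(1 - β))
    have := harc 15 (by norm_num) (by linarith)
    norm_num at this hb
    linarith

/-! ### Uniqueness of profiles and reduction of the beam equation -/

namespace IsHomoclinicProfile

/-- The travelling wave equation is a first order system with Lipschitz right-hand side. -/
theorem eq_of_eq_at {x x₁ x₂ x₃ : ℝ → ℝ} (hy : IsHomoclinicProfile γ β y y₁ y₂ y₃)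
    (hx : IsHomoclinicProfile γ β x x₁ x₂ x₃) {T : ℝ} (h0 : y T = x T) (h1 : y₁ T = x₁ T)
    (h2 : y₂ T = x₂ T) (h3 : y₃ T = x₃ T) : y = x := by
  let v : ℝ → ℝ × ℝ × ℝ × ℝ → ℝ × ℝ × ℝ × ℝ := fun _ w =>
    (w.2.1, w.2.2.1, w.2.2.2, 1 - γ * w.2.2.1 - max w.1 0 + β * max (-w.1) 0)
  obtain ⟨K, hK⟩ : ∃ K, ∀ t, LipschitzWith K (v t) := by
    have p0 : LipschitzWith 1 (fun w : ℝ × ℝ × ℝ × ℝ => w.1) := LipschitzWith.prod_fst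
    have p1 := LipschitzWith.prod_fst.comp (LipschitzWith.prod_snd (α := ℝ) (β := ℝ × ℝ × ℝ))
    have q2 := LipschitzWith.prod_snd.comp (LipschitzWith.prod_snd (α := ℝ) (β := ℝ × ℝ × ℝ))
    have p2 := LipschitzWith.prod_fst.comp q2
    have p3 := LipschitzWith.prod_snd.comp q2
    have m1 := (lipschitzWith_smul γ).comp p2
    have m2 := p0.max_const 0
    have m3 := (lipschitzWith_smul β).comp (p0.neg.max_const 0)
    exact ⟨_, fun _ => p1.prodMk (p2.prodMk (p3.prodMk
      ((((LipschitzWith.const (1 : ℝ)).sub m1).sub m2).add m3)))⟩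
  have hsol : ∀ {z z₁ z₂ z₃ : ℝ → ℝ}, IsHomoclinicProfile γ β z z₁ z₂ z₃ → ∀ t,
      HasDerivAt (fun t => (z t, z₁ t, z₂ t, z₃ t)) (v t (z t, z₁ t, z₂ t, z₃ t)) t ∧
        (z t, z₁ t, z₂ t, z₃ t) ∈ (univ : Set (ℝ × ℝ × ℝ × ℝ)) := fun {z z₁ z₂ z₃} hz t =>
    ⟨(hz.deriv_zero t).prodMk ((hz.deriv_one t).prodMk ((hz.deriv_two t).prodMk
      (hz.deriv_three t))), mem_univ _⟩
  have := ODE_solution_unique_univ (fun t => (hK t).lipschitzOnWith) (hsol hy) (hsol hx)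
    (t₀ := T) (by simp only [h0, h1, h2, h3])
  exact funext fun t => congrArg Prod.fst (congrFun this t)

/-- Position and slope of the edge of the trough determine the profile, because beyond the edge the
profile lies on the two-dimensional stable manifold. -/
theorem eq_of_edge {x x₁ x₂ x₃ : ℝ → ℝ} (hy : IsHomoclinicProfile γ β y y₁ y₂ y₃)
    (hx : IsHomoclinicProfile γ β x x₁ x₂ x₃) (hp : IsSpectralData γ β p q α ω) {T : ℝ}
    (hyT : y T = 0) (hxT : x T = 0) (hyout : ∀ t, T < t → 0 < y t) (hxout : ∀ t, T < t → 0 < x t)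
    (h1 : y₁ T = x₁ T) : y = x := by
  have hge : ∀ {z : ℝ → ℝ}, z T = 0 → (∀ t, T < t → 0 < z t) → ∀ t ∈ Ici T, 0 ≤ z t := by
    intro z h0 h t ht
    rcases eq_or_lt_of_le (show T ≤ t from ht) with rfl | h'
    · exact h0.ge
    · exact (h t h').le
  obtain ⟨a2, a3⟩ := hy.stable hp (hge hyT hyout) T self_mem_Ici
  obtain ⟨b2, b3⟩ := hx.stable hp (hge hxT hxout) T self_mem_Ici
  have h2 : y₂ T = x₂ T := by
    rw [hyT] at a2
    rw [hxT] at b2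
    rw [h1] at a2
    linarith
  refine hy.eq_of_eq_at hx (hyT.trans hxT.symm) h1 h2 ?_
  rw [h1, h2] at a3
  linarith

end IsHomoclinicProfile

theorem iteratedDeriv_const_mul_comp_affine {n : ℕ} {f : ℝ → ℝ} (hf : ContDiff ℝ n f)
    (b m d x : ℝ) : iteratedDeriv n (fun r => b * f (m * r + d)) x =
      b * (m ^ n * iteratedDeriv n f (m * x + d)) := by
  have h1 : ContDiff ℝ n (fun z => f (z + d)) := hf.comp (contDiff_id.add contDiff_const)
  rw [iteratedDeriv_const_mul_field, iteratedDeriv_comp_const_mul h1 m]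
  simp only [iteratedDeriv_comp_add_const]

theorem isHomoclinicProfile_of_wave {a b c : ℝ} (ha : 0 < a) {u : ℝ → ℝ → ℝ}
    (hu : IsBeamSolution a b u) (hw : IsTravellingWave a c u y) (he : Function.Even y) :
    IsHomoclinicProfile (c ^ 2) (b / a) y (iteratedDeriv 1 y) (iteratedDeriv 2 y)
      (iteratedDeriv 3 y) := by
  unfold IsTravellingWave at hw
  set κ := a ^ (1 / 4 : ℝ) with hκ
  have hκ0 : 0 < κ := Real.rpow_pos_of_pos ha _
  have hκ4 : κ ^ 4 = a := by
    rw [hκ, ← Real.rpow_natCast, ← Real.rpow_mul ha.le]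
    norm_num
  have hs2 : √a ^ 2 = a := Real.sq_sqrt ha.le
  set σ := c * √a with hσ
  have hux : ∀ τ, (fun x => u x τ) = fun x => a⁻¹ * y (κ * x + -(σ * τ)) := fun τ => by
    funext x
    rw [← sub_eq_add_neg, ← hw, inv_mul_cancel_left₀ ha.ne']
  have huτ : ∀ x, (fun τ => u x τ) = fun τ => a⁻¹ * y (-σ * τ + κ * x) := fun x => by
    funext τ
    rw [show -σ * τ + κ * x = κ * x - σ * τ by ring, ← hw, inv_mul_cancel_left₀ ha.ne']
  -- The profile is read off from the wave at time `1`, at the point `(ξ + σ) / κ`.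
  have hpt : ∀ ξ, κ * ((ξ + σ) / κ) + -(σ * 1) = ξ := fun ξ => by field_simp; ring
  have hcd : ContDiff ℝ 4 y := by
    have h1 : y = fun ξ => a * (fun x => u x 1) ((ξ + σ) / κ) := by
      funext ξ
      rw [hux]
      simp only
      rw [hpt, mul_inv_cancel_left₀ ha.ne']
    rw [h1]
    exact contDiff_const.mul ((hu.contDiff_space 1 one_pos).comp
      ((contDiff_id.add contDiff_const).div_const κ))
  have hder : ∀ n : ℕ, n < 4 → ∀ t, HasDerivAt (iteratedDeriv n y) (iteratedDeriv (n + 1) y t) t := by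
    intro n hn t
    rw [iteratedDeriv_succ]
    exact ((hcd.differentiable_iteratedDeriv n (by exact_mod_cast hn)) t).hasDerivAt
  have hlim : Tendsto (fun ξ => (ξ + σ) / κ) atTop (cocompact ℝ) :=
    ((tendsto_atTop_add_const_right _ σ tendsto_id).atTop_div_const hκ0).mono_right
      atTop_le_cocompact
  refine ⟨he, fun t => ?_, hder 1 (by norm_num), hder 2 (by norm_num), fun t => ?_, ?_, ?_⟩
  · simpa using hder 0 (by norm_num) t
  · refine (hder 3 (by norm_num) t).congr_deriv ?_
    have h := hu.equation ((t + σ) / κ) 1 one_pos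
    have hval : u ((t + σ) / κ) 1 = a⁻¹ * y t := by
      rw [congrFun (hux 1), hpt]
    rw [huτ, hux, iteratedDeriv_const_mul_comp_affine (hcd.of_le (by norm_num)),
      iteratedDeriv_const_mul_comp_affine hcd, hval,
      show -σ * 1 + κ * ((t + σ) / κ) = t by linarith [hpt t], hpt, hκ4,
      show (-σ) ^ 2 = c ^ 2 * a by rw [neg_sq, hσ, mul_pow, hs2]] at h
    have hinv := inv_pos.2 ha
    rw [show max (a⁻¹ * y t) 0 = a⁻¹ * max (y t) 0 by
        rw [mul_max_of_nonneg _ _ hinv.le, mul_zero],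
      show max (-(a⁻¹ * y t)) 0 = a⁻¹ * max (-(y t)) 0 by
        rw [mul_max_of_nonneg _ _ hinv.le, mul_zero, mul_neg]] at h
    field_simp at h ⊢
    linarith
  · have h := ((hu.tendsto_value 1 one_pos).comp hlim).const_mul a
    rw [mul_one_div_cancel ha.ne'] at h
    refine h.congr fun ξ => ?_
    rw [Function.comp_apply, hw, sub_eq_add_neg, hpt]
  · have h := ((hu.tendsto_slope 1 one_pos).comp hlim).const_mul (a * κ⁻¹)
    rw [mul_zero] at h
    refine h.congr fun ξ => ?_
    rw [Function.comp_apply, hux, ← iteratedDeriv_one,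
      iteratedDeriv_const_mul_comp_affine (n := 1) (hcd.of_le (by norm_num)), hpt]
    field_simp

theorem theorem1 (a b c : ℝ) (ha : 0 < a) (hc : c ^ 2 ∈ Set.Ioo (0 : ℝ) 2)
    (hb : b / a ∈ Set.Ioo (0 : ℝ) (c ^ 4 / 4)) :
    (evenOneTroughedWaves a b c).encard ≤ 6 := by
  obtain ⟨p, q, α, ω, hp⟩ := exists_isSpectralData hc
    (show b / a ∈ Ioo 0 ((c ^ 2) ^ 2 / 4) by rwa [← pow_mul])
  have key : ∀ u ∈ evenOneTroughedWaves a b c, ∃ n : ℤ, n ∈ Finset.Ico (0 : ℤ) 6 ∧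
      ∃ (y : ℝ → ℝ) (T : ℝ), IsTravellingWave a c u y ∧
        IsHomoclinicProfile (c ^ 2) (b / a) y (iteratedDeriv 1 y) (iteratedDeriv 2 y)
          (iteratedDeriv 3 y) ∧
        y T = 0 ∧ (∀ t, T < t → 0 < y t) ∧ IsTroughEdge (b / a) p q (iteratedDeriv 1 y T) T n := by
    rintro u ⟨hu, y, hw, he, htr⟩
    have hy := isHomoclinicProfile_of_wave ha hu hw he
    have htr' : {t | y t = 0}.encard = 2 := by
      unfold IsOneTroughed at htr
      simpa only [sub_eq_neg_self] using htr
    obtain ⟨T, hT, hyT, hout, hin⟩ := hy.exists_trough hp htr'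
    obtain ⟨n, hn⟩ := hy.exists_isTroughEdge hp hT hyT hout hin
    have hlo := hn.neg_one_lt hp
    have hhi := hn.lt_six hp (hy.slope_lt hp hyT hout)
    exact ⟨n, Finset.mem_Ico.2 ⟨by omega, hhi⟩, y, T, hw, hy, hyT, hout, hn⟩
  choose! N hN hR using key
  have hinj : InjOn N (evenOneTroughedWaves a b c) := by
    intro u hu u' hu' hNN
    obtain ⟨y, T, hw, hy, hyT, hout, hn⟩ := hR u hu
    obtain ⟨y', T', hw', hy', hyT', hout', hn'⟩ := hR u' hu'
    rw [← hNN] at hn'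
    obtain ⟨hs, rfl⟩ := hn.unique hp.p_pos hp.p_lt_q hn'
    obtain rfl := hy.eq_of_edge hy' hp hyT hyT' hout hout' hs
    funext x τ
    exact mul_left_cancel₀ ha.ne' ((hw x τ).trans (hw' x τ).symm)
  refine (encard_le_encard_of_injOn (t := (Finset.Ico (0 : ℤ) 6 : Finset ℤ))
    (fun u hu => hN u hu) hinj).trans ?_
  rw [encard_coe_eq_coe_finsetCard]
  simp
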